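/- Let $(X,d)$ be a complete metric space, $\lambda\in\mathbb R$, and let $\phi:X\to(-\infty,\infty]$ be lower semi-continuous with $D(\phi):=\{\phi<\infty\}\neq\emptyset$. A minimal geodesic is a curve $\gamma:[0,1]\to X$ with $d(\gamma(s),\gamma(t))=|s-t|\,d(\gamma(0),\gamma(1))$ for all $s,t\in[0,1]$. We say that $\phi$ is $\lambda$-convex along $\gamma$ if $\phi(\gamma(t))\le(1-t)\phi(\gamma(0))+t\phi(\gamma(1))-\frac{\lambda}{2}(1-t)t\,d^2(\gamma(0),\gamma(1))$ for all $t\in[0,1]$. For $\tau>0$ and $x\in X$ put $\phi_\tau(x):=\inf_{z\in X}\{\phi(z)+\frac{d^2(x,z)}{2\tau}\}$ and let $J_\tau(x)$ be the set of points $z$ attaining this infimum. Assume one of the following. (I) $(X,d)$ is a (geodesic) $\mathrm{CAT}(1)$-space, and any $x,y\in D(\phi)$ are joined by some minimal geodesic along which $\phi$ is $\lambda$-convex. (II) $\phi$ is coercive, i.e. there is $\tau_*>0$ such that $\phi_\tau(x)>-\infty$ and $J_\tau(x)\ne\emptyset$ for all $x\in X$ and $\tau\in(0,\tau_*)$; and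 there are $K\in\mathbb R$ and a family $\Gamma$ of minimal geodesics joining any two points of $D(\phi)$ such that: $\phi$ is $\lambda$-convex along every $\gamma\in\Gamma$ with end points in $D(\phi)$; for every $z\in X$ the function $d^2(\cdot,z)$ is $K$-convex along every $\gamma\in\Gamma$; and for all $\gamma,\eta\in\Gamma$ with $\gamma(0)=\eta(0)$ the commutativity $$\lim_{s\downarrow0}\frac{d^2(\gamma(s),\eta(1))-d^2(\gamma(0),\eta(1))}{s}=\lim_{t\downarrow0}\frac{d^2(\eta(t),\gamma(1))-d^2(\eta(0),\gamma(1))}{t}$$ holds. For $x_0\in D(\phi)$, a gradient curve starting from $x_0$ is a curve $\xi:[0,\infty)\to X$ that is the pointwise limit, as $i\to\infty$, of curves $\bar x_i$ of the following form: there are partitions $0=t_i^0<t_i^1<\cdots\to\infty$ with $\sup_k(t_i^k-t_i^{k-1})\to0$ as $i\to\infty$ and points $x_i^0=x_0$, $x_i^k\in J_{t_i^k-t_i^{k-1}}(x_i^{k-1})$, such that $\bar x_i(0)=x_0$ and $\bar x_i(t)=x_i^k$ for $t\in(t_i^{k-1},t_i^k]$. (This is the curve $\xi(t)=\mathcal G(t,x_0)$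 of the gradient flow $\mathcal G$ of $\phi$.) For $x\in D(\phi)$ the local slope is $|\nabla\phi|(x):=\limsup_{y\to x}\frac{\max\{\phi(x)-\phi(y),0\}}{d(x,y)}\in[0,\infty]$, which is $0$ if $x$ is isolated; outside $D(\phi)$ it is set to $\infty$. Let $x_0\in D(\phi)$ and let $\xi$ be a gradient curve starting from $x_0$. (i) (Large time behavior.) If $\phi(\xi(t))$ stays bounded below as $t\to\infty$ (that is, $\lim_{t\to\infty}\phi(\xi(t))>-\infty$), then $\lim_{t\to\infty}|\nabla\phi|(\xi(t))=0$. (ii) If $t_n\to\infty$ and $\xi(t_n)\to\bar x$ for some sequence $(t_n)$ and some $\bar x\in X$, then $\bar x$ is a stationary point, that is, $\bar x\in D(\phi)$, $|\nabla\phi|(\bar x)=0$, and the constant curve $t\mapsto\bar x$ is the unique gradient curve starting from $\bar x$; moreover $\lim_{t\to\infty}\phi(\xi(t))=\phi(\bar x)$. -/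

import Mathlib

open Filter Topology

/-- The effective domain `D(φ)` of `φ : X → (-∞, ∞]`. -/
def effDomain {X : Type*} (φ : X → EReal) : Set X := {x | φ x ≠ ⊤}

/-- `γ`, restricted to `[0,1]`, is a minimal geodesic from `x` to `y` for the distance function
`d`. It is used for metric spaces and for the round sphere with its angular distance. -/
def IsMinimalGeodesic {Y : Type*} (d : Y → Y → ℝ) (γ : ℝ → Y) (x y : Y) : Prop :=
  γ 0 = x ∧ γ 1 = y ∧
    ∀ s ∈ Set.Icc (0 : ℝ) 1, ∀ t ∈ Set.Icc (0 : ℝ) 1, d (γ s) (γ t) = |s - t| * d x y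

/-- The unit sphere `𝕊²` in `ℝ³`. -/
abbrev UnitTwoSphere : Type := Metric.sphere (0 : EuclideanSpace ℝ (Fin 3)) 1

/-- The angular (intrinsic Riemannian) distance of `𝕊²`. -/
noncomputable def sphereDist (u v : UnitTwoSphere) : ℝ :=
  InnerProductGeometry.angle (u : EuclideanSpace ℝ (Fin 3)) (v : EuclideanSpace ℝ (Fin 3))

/-- `CAT(1)`-spaces: geodesic metric spaces in which every triangle `x, y, z` of perimeter less
than `2π` is not thicker than its comparison triangle `x', y', z'` in `𝕊²`. (Comparison triangles
exist and are unique up to rigid motion; all their sides are shorter than `π`.) -/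
def IsCATOne (X : Type*) [MetricSpace X] : Prop :=
  (∀ x y : X, ∃ γ : ℝ → X, IsMinimalGeodesic dist γ x y) ∧
  ∀ (x y z : X) (γ : ℝ → X), dist x y + dist y z + dist z x < 2 * Real.pi →
    IsMinimalGeodesic dist γ y z →
    ∀ (x' y' z' : UnitTwoSphere) (γ' : ℝ → UnitTwoSphere),
      sphereDist x' y' = dist x y → sphereDist y' z' = dist y z → sphereDist z' x' = dist z x →
      IsMinimalGeodesic sphereDist γ' y' z' →
      ∀ t ∈ Set.Icc (0 : ℝ) 1, dist x (γ t) ≤ sphereDist x' (γ' t)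

section Functionals

variable {X : Type*} [MetricSpace X]

/-- The `lam`-convexity inequality for `φ : X → (-∞, ∞]` along `γ : [0,1] → X`, where the two
end points of `γ` are meant to lie in `D(φ)`. -/
def ConvexAlong (φ : X → EReal) (lam : ℝ) (γ : ℝ → X) : Prop :=
  ∀ t ∈ Set.Icc (0 : ℝ) 1,
    φ (γ t) ≤ (((1 - t) * (φ (γ 0)).toReal + t * (φ (γ 1)).toReal
      - lam / 2 * (1 - t) * t * dist (γ 0) (γ 1) ^ 2 : ℝ) : EReal)

/-- `φ` is `lam`-(geodesically) convex: any two points of `D(φ)` are joined by some minimal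
geodesic along which the `lam`-convexity inequality holds. -/
def IsGeodConvex (φ : X → EReal) (lam : ℝ) : Prop :=
  ∀ x ∈ effDomain φ, ∀ y ∈ effDomain φ,
    ∃ γ : ℝ → X, IsMinimalGeodesic dist γ x y ∧ ConvexAlong φ lam γ

/-- `K`-convexity along `γ` of the squared distance function from every point. -/
def SqDistConvexAlong (K : ℝ) (γ : ℝ → X) : Prop :=
  ∀ z : X, ∀ t ∈ Set.Icc (0 : ℝ) 1,
    dist (γ t) z ^ 2 ≤ (1 - t) * dist (γ 0) z ^ 2 + t * dist (γ 1) z ^ 2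
      - K / 2 * (1 - t) * t * dist (γ 0) (γ 1) ^ 2

/-- The commutativity of two geodesics `γ`, `η` issuing from the same point `γ 0 = η 0`:
the derivative at `0` of the squared distance to `η 1` along `γ` and the derivative at `0` of
the squared distance to `γ 1` along `η` exist and agree. -/
def GeodesicsCommute (γ η : ℝ → X) : Prop :=
  ∃ l : ℝ,
    Tendsto (fun s : ℝ => (dist (γ s) (η 1) ^ 2 - dist (γ 0) (η 1) ^ 2) / s)
      (𝓝[>] 0) (𝓝 l) ∧
    Tendsto (fun t : ℝ => (dist (η t) (γ 1) ^ 2 - dist (η 0) (γ 1) ^ 2) / t)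
      (𝓝[>] 0) (𝓝 l)

/-- The Moreau-Yosida approximation `φ_τ(x) = inf_z {φ(z) + d²(x,z)/(2τ)}`. -/
noncomputable def moreauYosida (φ : X → EReal) (τ : ℝ) (x : X) : EReal :=
  ⨅ z : X, φ z + ((dist x z ^ 2 / (2 * τ) : ℝ) : EReal)

/-- The set `J_τ(x)` of the points attaining the infimum in `φ_τ(x)`. -/
def minimizerSet (φ : X → EReal) (τ : ℝ) (x : X) : Set X :=
  {z | φ z + ((dist x z ^ 2 / (2 * τ) : ℝ) : EReal) = moreauYosida φ τ x}

/-- Coercivity: there is a threshold `τ' > 0` such that `φ_τ(x) > -∞` and `J_τ(x) ≠ ∅` for all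
`x ∈ X` and all `τ ∈ (0, τ')`. -/
def IsCoerciveFun (φ : X → EReal) : Prop :=
  ∃ τ' : ℝ, 0 < τ' ∧ ∀ (x : X) (τ : ℝ), 0 < τ → τ < τ' →
    moreauYosida φ τ x ≠ ⊥ ∧ (minimizerSet φ τ x).Nonempty

/-- The descending local slope
`|∇φ|(x) = limsup_{y → x} max{φ(x) - φ(y), 0} / d(x,y) ∈ [0,∞]` for `x ∈ D(φ)`
(it is `0` at isolated points), and `∞` outside of `D(φ)`. -/
noncomputable def localSlope (φ : X → EReal) (x : X) : ENNReal :=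
  open scoped Classical in
  if φ x = ⊤ then ⊤ else limsup (fun y => (φ x - φ y).toENNReal / edist x y) (𝓝[≠] x)

/-- `x` is a discrete solution of the variational scheme with initial point `x₀` associated with
the partition `0 = t 0 < t 1 < ⋯ → ∞` of `[0,∞)`. -/
def IsDiscreteSolution (φ : X → EReal) (x₀ : X) (t : ℕ → ℝ) (x : ℕ → X) : Prop :=
  t 0 = 0 ∧ StrictMono t ∧ Tendsto t atTop atTop ∧
    x 0 = x₀ ∧ ∀ k : ℕ, x (k + 1) ∈ minimizerSet φ (t (k + 1) - t k) (x k)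

/-- The interpolated curve: `x 0` at time `0`, and `x k` at the times in `(t (k - 1), t k]`. -/
noncomputable def interpolatedCurve (t : ℕ → ℝ) (x : ℕ → X) (s : ℝ) : X :=
  x (sInf {k : ℕ | s ≤ t k})

/-- `ξ : [0,∞) → X` is a gradient curve of `φ` starting from `x₀`: it is the pointwise limit of
the interpolated curves of a sequence of discrete solutions starting from `x₀` whose partitions
have mesh tending to `0`. (Only the values of `ξ` on `[0,∞)` matter.) -/
def IsGradientCurve (φ : X → EReal) (x₀ : X) (ξ : ℝ → X) : Prop :=
  ∃ (t : ℕ → ℕ → ℝ) (x : ℕ → ℕ → X),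
    (∀ i, IsDiscreteSolution φ x₀ (t i) (x i)) ∧
    (∀ ε : ℝ, 0 < ε → ∀ᶠ i in atTop, ∀ k, t i (k + 1) - t i k ≤ ε) ∧
    ∀ s : ℝ, 0 ≤ s → Tendsto (fun i => interpolatedCurve (t i) (x i) s) atTop (𝓝 (ξ s))

/-- `x` is a stationary point of the gradient flow of `φ`: it lies in `D(φ)`, and the gradient
curve starting from `x` is constant, i.e. the constant curve is the one and only gradient curve
starting from `x`. -/
def IsStationaryPoint (φ : X → EReal) (x : X) : Prop :=
  x ∈ effDomain φ ∧ IsGradientCurve φ x (fun _ => x) ∧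
    ∀ ζ : ℝ → X, IsGradientCurve φ x ζ → ∀ t : ℝ, 0 ≤ t → ζ t = x

/-- First admissible case: the space is `CAT(1)` and `φ` is `lam`-convex. -/
def CaseCATOne (φ : X → EReal) (lam : ℝ) : Prop :=
  IsCATOne X ∧ IsGeodConvex φ lam

/-- Second admissible case: `φ` is coercive and there is a family `Γ` of minimal geodesics, joining
any two points of `D(φ)`, along which the commutativity, the `K`-convexity of the squared distance
function (for some `K ∈ ℝ`), and the `lam`-convexity of `φ` hold simultaneously. -/
def CaseCommutative (φ : X → EReal) (lam : ℝ) : Prop :=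
  IsCoerciveFun φ ∧ ∃ (K : ℝ) (Γ : Set (ℝ → X)),
    (∀ γ ∈ Γ, IsMinimalGeodesic dist γ (γ 0) (γ 1)) ∧
    (∀ x ∈ effDomain φ, ∀ y ∈ effDomain φ, ∃ γ ∈ Γ, γ 0 = x ∧ γ 1 = y) ∧
    (∀ γ ∈ Γ, ∀ η ∈ Γ, γ 0 = η 0 → GeodesicsCommute γ η) ∧
    (∀ γ ∈ Γ, SqDistConvexAlong K γ) ∧
    (∀ γ ∈ Γ, γ 0 ∈ effDomain φ → γ 1 ∈ effDomain φ → ConvexAlong φ lam γ)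

end Functionals

/-!
If `p ∈ J_τ(x)`, then the global slope of `φ` at `p` is at most `d(x,p)/τ`, and convexity bounds
`(1 - κτ) d(x,p)/τ` by the global slope at `x`, where `κ = |lam|`. So the slope almost decreases
along a discrete solution, whereas `∑ τ_k (d(x_{k-1},x_k)/τ_k)²` is at most twice the drop of `φ`.
Hence the slope at the end of a time span `T` is at most `√(2 exp(4κT) (drop of φ) / T)`. Locally
bounded global slopes upgrade lower semicontinuity to convergence of the values of `φ`, so the
bound survives in the limit curve `ξ`. Once `φ(ξ(t))` converges, its drop over `[t - 1, t]` tends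
to `0`, and so does the slope.
-/

section Functional

lemma mem_effDomain_and_toReal_le_iff {X : Type*} {φ : X → EReal} (hbot : ∀ x, φ x ≠ ⊥) {x : X}
    {M : ℝ} :
    x ∈ effDomain φ ∧ (φ x).toReal ≤ M ↔ φ x ≤ M := by
  constructor
  · rintro ⟨hx, hM⟩
    rw [← EReal.coe_toReal hx (hbot x)]
    exact_mod_cast hM
  · intro hM
    have hx : φ x ≠ ⊤ := (hM.trans_lt (EReal.coe_lt_top M)).ne
    refine ⟨hx, ?_⟩
    rwa [← EReal.coe_toReal hx (hbot x), EReal.coe_le_coe_iff] at hM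

variable {X : Type*} [MetricSpace X] {φ : X → EReal}

lemma mem_effDomain_and_toReal_le_of_tendsto (hbot : ∀ x, φ x ≠ ⊥) (hlsc : LowerSemicontinuous φ)
    {ι : Type*} {l : Filter ι} [l.NeBot] {u : ι → X} {y : X} {M : ℝ} (hu : Tendsto u l (𝓝 y))
    (hM : ∀ᶠ i in l, u i ∈ effDomain φ ∧ (φ (u i)).toReal ≤ M) :
    y ∈ effDomain φ ∧ (φ y).toReal ≤ M := by
  simp only [mem_effDomain_and_toReal_le_iff hbot] at hM ⊢
  exact (hlsc.isClosed_preimage (M : EReal)).mem_of_tendsto hu hM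

lemma eventually_lt_toReal_of_tendsto (hbot : ∀ x, φ x ≠ ⊥) (hlsc : LowerSemicontinuous φ)
    {ι : Type*} {l : Filter ι} {u : ι → X} {y : X} {c : ℝ} (hu : Tendsto u l (𝓝 y))
    (hy : y ∈ effDomain φ) (hmem : ∀ᶠ i in l, u i ∈ effDomain φ) (hc : c < (φ y).toReal) :
    ∀ᶠ i in l, c < (φ (u i)).toReal := by
  have hcy : (c : EReal) < φ y := by
    rw [← EReal.coe_toReal hy (hbot y)]
    exact_mod_cast hc
  filter_upwards [hu.eventually (hlsc y c hcy), hmem] with i hi hiD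
  exact EReal.coe_lt_coe_iff.1 (hi.trans_eq (EReal.coe_toReal hiD (hbot _)).symm)

lemma ConvexAlong.mem_effDomain_and_toReal_le (hbot : ∀ x, φ x ≠ ⊥) {lam : ℝ} {γ : ℝ → X}
    (h : ConvexAlong φ lam γ) {s : ℝ} (hs : s ∈ Set.Icc (0 : ℝ) 1) :
    γ s ∈ effDomain φ ∧ (φ (γ s)).toReal ≤ (1 - s) * (φ (γ 0)).toReal + s * (φ (γ 1)).toReal
      - lam / 2 * (1 - s) * s * dist (γ 0) (γ 1) ^ 2 :=
  (mem_effDomain_and_toReal_le_iff hbot).2 (h s hs)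

/-- Divide the convexity inequality by `s` and let `s → 0`. -/
lemma ConvexAlong.sub_le_of_forall_sub_le (hbot : ∀ x, φ x ≠ ⊥) {lam a b : ℝ} {γ : ℝ → X}
    (h : ConvexAlong φ lam γ)
    (hab : ∀ s ∈ Set.Ioo (0 : ℝ) 1, γ s ∈ effDomain φ →
      (φ (γ 0)).toReal - (φ (γ s)).toReal ≤ s * a + s ^ 2 * b) :
    (φ (γ 0)).toReal - (φ (γ 1)).toReal ≤ a - lam / 2 * dist (γ 0) (γ 1) ^ 2 := by
  have hlim : Tendsto (fun s : ℝ => a + s * b - lam / 2 * (1 - s) * dist (γ 0) (γ 1) ^ 2)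
      (𝓝[>] 0) (𝓝 (a + 0 * b - lam / 2 * (1 - 0) * dist (γ 0) (γ 1) ^ 2)) :=
    (Continuous.tendsto (by fun_prop) 0).mono_left nhdsWithin_le_nhds
  rw [zero_mul, add_zero, sub_zero, mul_one] at hlim
  refine ge_of_tendsto hlim ?_
  filter_upwards [Ioo_mem_nhdsGT one_pos] with s hs
  obtain ⟨hD, hle⟩ := h.mem_effDomain_and_toReal_le hbot (Set.Ioo_subset_Icc_self hs)
  refine le_of_mul_le_mul_left ?_ hs.1
  linarith [hab s hs hD]

lemma IsGeodConvex.mono {lam lam' : ℝ} (hlam : lam' ≤ lam) (h : IsGeodConvex φ lam) :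
    IsGeodConvex φ lam' := by
  intro x hx y hy
  obtain ⟨γ, hγ, hconv⟩ := h x hx y hy
  refine ⟨γ, hγ, fun s hs => (hconv s hs).trans (EReal.coe_le_coe_iff.2 ?_)⟩
  have hs0 := hs.1
  have hs1 : 0 ≤ 1 - s := sub_nonneg.2 hs.2
  gcongr

lemma CaseCommutative.isGeodConvex {lam : ℝ} (h : CaseCommutative φ lam) :
    IsGeodConvex φ lam := by
  obtain ⟨-, -, Γ, hgeod, hjoin, -, -, hconv⟩ := h
  rintro x hx y hy
  obtain ⟨γ, hγ, rfl, rfl⟩ := hjoin x hx y hy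
  exact ⟨γ, hgeod γ hγ, hconv γ hγ hx hy⟩

end Functional

section GlobalSlope

variable {X : Type*} [MetricSpace X] {φ : X → EReal} {κ q : ℝ} {x : X}

/-- The point `x` lies in `D(φ)` and the global slope of a `(-κ)`-convex `φ` at `x`, that is,
`sup_{z ≠ x} ((φ(x) - φ(z)) / d(x,z) - κ/2 d(x,z))`, is at most `q`. The bound is multiplied out
by `d(x,z)` to avoid division. -/
structure GlobalSlopeLE (φ : X → EReal) (κ q : ℝ) (x : X) : Prop where
  mem : x ∈ effDomain φ
  sub_le : ∀ z ∈ effDomain φ,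
    (φ x).toReal - (φ z).toReal ≤ q * dist x z + κ / 2 * dist x z ^ 2

namespace GlobalSlopeLE

lemma mono {q' : ℝ} (h : GlobalSlopeLE φ κ q x) (hq : q ≤ q') : GlobalSlopeLE φ κ q' x :=
  ⟨h.mem, fun z hz => (h.sub_le z hz).trans (by gcongr)⟩

/-- The slope is decided by nearby points, so convexity replaces any constant `κ'` by `κ`. -/
lemma of_isGeodConvex (hbot : ∀ x, φ x ≠ ⊥) (hconv : IsGeodConvex φ (-κ)) {κ' : ℝ}
    (h : GlobalSlopeLE φ κ' q x) : GlobalSlopeLE φ κ q x := by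
  refine ⟨h.mem, fun z hz => ?_⟩
  obtain ⟨γ, ⟨rfl, rfl, hgeod⟩, hγ⟩ := hconv x h.mem z hz
  refine (hγ.sub_le_of_forall_sub_le hbot (a := q * dist (γ 0) (γ 1))
    (b := κ' / 2 * dist (γ 0) (γ 1) ^ 2) fun s hs hD => ?_).trans_eq (by ring)
  have hdist : dist (γ 0) (γ s) = s * dist (γ 0) (γ 1) := by
    rw [hgeod 0 (by simp) s (Set.Ioo_subset_Icc_self hs), zero_sub, abs_neg, abs_of_pos hs.1]
  refine (h.sub_le _ hD).trans_eq ?_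
  rw [hdist]
  ring

lemma localSlope_le (hbot : ∀ x, φ x ≠ ⊥) (h : GlobalSlopeLE φ κ q x) :
    localSlope φ x ≤ ENNReal.ofReal q := by
  rw [localSlope, if_neg h.mem]
  refine ENNReal.le_of_forall_pos_le_add fun ε hε _ => limsup_le_of_le (by isBoundedDefault) ?_
  have hlim : Tendsto (fun y => κ / 2 * dist x y) (𝓝 x) (𝓝 (κ / 2 * dist x x)) :=
    Continuous.tendsto (by fun_prop) x
  rw [dist_self, mul_zero] at hlim
  filter_upwards [nhdsWithin_le_nhds (hlim.eventually_lt_const (NNReal.coe_pos.2 hε))] with y hy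
  refine ENNReal.div_le_of_le_mul ?_
  by_cases hyD : φ y = ⊤
  · simp [hyD]
  have hsub : φ x - φ y = (((φ x).toReal - (φ y).toReal : ℝ) : EReal) := by
    rw [EReal.coe_sub, EReal.coe_toReal h.mem (hbot x), EReal.coe_toReal hyD (hbot y)]
  have hε' : κ / 2 * dist x y ^ 2 ≤ ε * dist x y := by
    rw [pow_two, ← mul_assoc]
    gcongr
  calc (φ x - φ y).toENNReal = ENNReal.ofReal ((φ x).toReal - (φ y).toReal) := by
        rw [hsub, EReal.toENNReal_of_ne_top (EReal.coe_ne_top _), EReal.toReal_coe]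
    _ ≤ ENNReal.ofReal (q * dist x y + ε * dist x y) :=
        ENNReal.ofReal_le_ofReal ((h.sub_le y hyD).trans (by linarith))
    _ ≤ ENNReal.ofReal (q * dist x y) + ENNReal.ofReal (ε * dist x y) := ENNReal.ofReal_add_le
    _ = (ENNReal.ofReal q + ε) * edist x y := by
        rw [ENNReal.ofReal_mul' dist_nonneg, ENNReal.ofReal_mul' dist_nonneg,
          ENNReal.ofReal_coe_nnreal, edist_dist, add_mul]

variable {ι : Type*} {l : Filter ι} {u : ι → X} {r : ι → ℝ}

lemma tendsto_toReal (hbot : ∀ x, φ x ≠ ⊥) (hlsc : LowerSemicontinuous φ)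
    (hx : x ∈ effDomain φ) (hu : Tendsto u l (𝓝 x)) (hr : Tendsto r l (𝓝 q))
    (h : ∀ᶠ i in l, GlobalSlopeLE φ κ (r i) (u i)) :
    Tendsto (fun i => (φ (u i)).toReal) l (𝓝 (φ x).toReal) := by
  refine tendsto_order.2 ⟨fun c hc => eventually_lt_toReal_of_tendsto hbot hlsc hu hx
    (h.mono fun i hi => hi.mem) hc, fun c hc => ?_⟩
  have hdist : Tendsto (fun i => dist (u i) x) l (𝓝 0) := tendsto_iff_dist_tendsto_zero.1 hu
  have hbound : Tendsto (fun i => (φ x).toReal + (r i * dist (u i) x + κ / 2 * dist (u i) x ^ 2))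
      l (𝓝 (φ x).toReal) := by
    simpa using ((hr.mul hdist).add ((hdist.pow 2).const_mul (κ / 2))).const_add (φ x).toReal
  filter_upwards [h, hbound.eventually_lt_const hc] with i hi hic
  linarith [hi.sub_le x hx]

lemma of_tendsto [l.NeBot] (hbot : ∀ x, φ x ≠ ⊥) (hlsc : LowerSemicontinuous φ)
    (hx : x ∈ effDomain φ) (hu : Tendsto u l (𝓝 x)) (hr : Tendsto r l (𝓝 q))
    (h : ∀ᶠ i in l, GlobalSlopeLE φ κ (r i) (u i)) : GlobalSlopeLE φ κ q x := by
  refine ⟨hx, fun z hz => ?_⟩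
  have hdist : Tendsto (fun i => dist (u i) z) l (𝓝 (dist x z)) := hu.dist tendsto_const_nhds
  exact le_of_tendsto_of_tendsto ((tendsto_toReal hbot hlsc hx hu hr h).sub_const _)
    ((hr.mul hdist).add ((hdist.pow 2).const_mul (κ / 2))) (h.mono fun i hi => hi.sub_le z hz)

end GlobalSlopeLE

end GlobalSlope

section Minimizer

variable {X : Type*} [MetricSpace X] {φ : X → EReal} {κ τ q : ℝ} {x p : X}

lemma mem_effDomain_of_mem_minimizerSet (hx : x ∈ effDomain φ) (hp : p ∈ minimizerSet φ τ x) :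
    p ∈ effDomain φ := by
  intro htop
  have hle : φ p + ((dist x p ^ 2 / (2 * τ) : ℝ) : EReal)
      ≤ φ x + ((dist x x ^ 2 / (2 * τ) : ℝ) : EReal) := (Eq.le hp).trans (iInf_le _ x)
  rw [htop, EReal.top_add_coe, top_le_iff] at hle
  exact EReal.add_ne_top hx (EReal.coe_ne_top _) hle

lemma mem_minimizerSet_iff (hbot : ∀ x, φ x ≠ ⊥) (hp : p ∈ effDomain φ) :
    p ∈ minimizerSet φ τ x ↔ ∀ z ∈ effDomain φ,
      (φ p).toReal + dist x p ^ 2 / (2 * τ) ≤ (φ z).toReal + dist x z ^ 2 / (2 * τ) := by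
  have hcoe : ∀ z ∈ effDomain φ, φ z + ((dist x z ^ 2 / (2 * τ) : ℝ) : EReal)
      = (((φ z).toReal + dist x z ^ 2 / (2 * τ) : ℝ) : EReal) := fun z hz => by
    rw [EReal.coe_add, EReal.coe_toReal hz (hbot z)]
  constructor
  · intro h z hz
    rw [← EReal.coe_le_coe_iff, ← hcoe p hp, ← hcoe z hz]
    exact (Eq.le h).trans (iInf_le _ z)
  · refine fun h => le_antisymm (le_iInf fun z => ?_) (iInf_le _ p)
    by_cases hz : φ z = ⊤
    · rw [hz, EReal.top_add_coe]
      exact le_top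
    · rw [hcoe p hp, hcoe z hz]
      exact_mod_cast h z hz

lemma toReal_sub_le_of_mem_minimizerSet (hbot : ∀ x, φ x ≠ ⊥) (hx : x ∈ effDomain φ)
    (hp : p ∈ minimizerSet φ τ x) {z : X} (hz : z ∈ effDomain φ) :
    (φ p).toReal - (φ z).toReal ≤ (dist x z ^ 2 - dist x p ^ 2) / (2 * τ) := by
  have := (mem_minimizerSet_iff hbot (mem_effDomain_of_mem_minimizerSet hx hp)).1 hp z hz
  rw [sub_div]
  linarith

lemma mul_dist_div_sq_le_of_mem_minimizerSet (hbot : ∀ x, φ x ≠ ⊥) (hx : x ∈ effDomain φ)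
    (hτ : 0 < τ) (hp : p ∈ minimizerSet φ τ x) :
    τ * (dist x p / τ) ^ 2 ≤ 2 * ((φ x).toReal - (φ p).toReal) := by
  have h := toReal_sub_le_of_mem_minimizerSet hbot hx hp hx
  rw [dist_self] at h
  have heq : τ * (dist x p / τ) ^ 2 = -2 * ((0 ^ 2 - dist x p ^ 2) / (2 * τ)) := by
    field_simp
    ring
  linarith

lemma toReal_le_of_mem_minimizerSet (hbot : ∀ x, φ x ≠ ⊥) (hx : x ∈ effDomain φ)
    (hτ : 0 < τ) (hp : p ∈ minimizerSet φ τ x) : (φ p).toReal ≤ (φ x).toReal := by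
  have h := mul_dist_div_sq_le_of_mem_minimizerSet hbot hx hτ hp
  have : 0 ≤ τ * (dist x p / τ) ^ 2 := by positivity
  linarith

lemma globalSlopeLE_of_mem_minimizerSet (hbot : ∀ x, φ x ≠ ⊥) (hx : x ∈ effDomain φ)
    (hτ : 0 < τ) (hp : p ∈ minimizerSet φ τ x) : GlobalSlopeLE φ (1 / τ) (dist x p / τ) p := by
  refine ⟨mem_effDomain_of_mem_minimizerSet hx hp, fun z hz => ?_⟩
  calc (φ p).toReal - (φ z).toReal ≤ (dist x z ^ 2 - dist x p ^ 2) / (2 * τ) :=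
        toReal_sub_le_of_mem_minimizerSet hbot hx hp hz
    _ ≤ ((dist x p + dist p z) ^ 2 - dist x p ^ 2) / (2 * τ) := by
        gcongr
        exact dist_triangle x p z
    _ = dist x p / τ * dist p z + 1 / τ / 2 * dist p z ^ 2 := by
        field_simp
        ring

/-- The test points are those of the geodesic from `p` back to `x`. -/
lemma IsGeodConvex.dist_sq_div_sub_le_of_mem_minimizerSet (hbot : ∀ x, φ x ≠ ⊥)
    (hconv : IsGeodConvex φ (-κ)) (hx : x ∈ effDomain φ) (hp : p ∈ minimizerSet φ τ x) :
    dist x p ^ 2 / τ - κ / 2 * dist x p ^ 2 ≤ (φ x).toReal - (φ p).toReal := by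
  obtain ⟨γ, ⟨rfl, rfl, hgeod⟩, hγ⟩ := hconv p (mem_effDomain_of_mem_minimizerSet hx hp) x hx
  have hdrop : (φ (γ 0)).toReal - (φ (γ 1)).toReal
      ≤ -(dist (γ 0) (γ 1) ^ 2 / τ) - -κ / 2 * dist (γ 0) (γ 1) ^ 2 := by
    refine hγ.sub_le_of_forall_sub_le hbot (b := dist (γ 0) (γ 1) ^ 2 / (2 * τ)) fun s hs hD => ?_
    have hdist : dist (γ 1) (γ s) = (1 - s) * dist (γ 0) (γ 1) := by
      rw [hgeod 1 (by simp) s (Set.Ioo_subset_Icc_self hs), abs_of_pos (sub_pos.2 hs.2)]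
    refine (toReal_sub_le_of_mem_minimizerSet hbot hx hp hD).trans_eq ?_
    rw [hdist, dist_comm (γ 1)]
    ring
  rw [dist_comm (γ 1)]
  linarith

lemma one_le_exp_two_mul_mul_one_sub {v : ℝ} (hv : 0 ≤ v) (hv2 : v ≤ 1 / 2) :
    1 ≤ Real.exp (2 * v) * (1 - v) := by
  have h : (2 * v + 1) * (1 - v) ≤ Real.exp (2 * v) * (1 - v) :=
    mul_le_mul_of_nonneg_right (Real.add_one_le_exp _) (by linarith)
  nlinarith

lemma GlobalSlopeLE.dist_div_le (hbot : ∀ x, φ x ≠ ⊥) (hconv : IsGeodConvex φ (-κ)) (hκ : 0 ≤ κ)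
    (hτ : 0 < τ) (hκτ : κ * τ ≤ 1 / 2) (hq : 0 ≤ q) (h : GlobalSlopeLE φ κ q x)
    (hp : p ∈ minimizerSet φ τ x) : dist x p / τ ≤ Real.exp (2 * (κ * τ)) * q := by
  have hdecay : (1 - κ * τ) * (dist x p / τ) ≤ q := by
    rcases eq_or_ne x p with rfl | hne
    · simpa using hq
    refine le_of_mul_le_mul_right ?_ (dist_pos.2 hne)
    have hpx := hconv.dist_sq_div_sub_le_of_mem_minimizerSet hbot h.mem hp
    have hxp := h.sub_le p (mem_effDomain_of_mem_minimizerSet h.mem hp)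
    calc (1 - κ * τ) * (dist x p / τ) * dist x p
        = dist x p ^ 2 / τ - κ * dist x p ^ 2 := by
          field_simp
      _ ≤ q * dist x p := by linarith
  calc dist x p / τ ≤ Real.exp (2 * (κ * τ)) * (1 - κ * τ) * (dist x p / τ) :=
        le_mul_of_one_le_left (by positivity)
          (one_le_exp_two_mul_mul_one_sub (by positivity) hκτ)
    _ = Real.exp (2 * (κ * τ)) * ((1 - κ * τ) * (dist x p / τ)) := mul_assoc _ _ _
    _ ≤ Real.exp (2 * (κ * τ)) * q := by gcongr

end Minimizer

section RegularizedSlope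

variable {κ T P τ ρ v : ℝ}

/-- The bound for the global slope of a `(-κ)`-convex functional at the end of a time span `T`
during which the functional has dropped by `P`. -/
noncomputable def regularizedSlope (κ T P : ℝ) : ℝ := √(2 * Real.exp (4 * κ * T) * P / T)

lemma regularizedSlope_mono (hT : 0 < T) : Monotone (regularizedSlope κ T) := fun P P' hP => by
  unfold regularizedSlope
  gcongr

lemma regularizedSlope_zero : regularizedSlope κ T 0 = 0 := by simp [regularizedSlope]

lemma tendsto_regularizedSlope {ι : Type*} {l : Filter ι} {T' P' : ι → ℝ} (hT : T ≠ 0)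
    (hT' : Tendsto T' l (𝓝 T)) (hP' : Tendsto P' l (𝓝 P)) :
    Tendsto (fun i => regularizedSlope κ (T' i) (P' i)) l (𝓝 (regularizedSlope κ T P)) :=
  (((((Real.continuous_exp.tendsto _).comp (hT'.const_mul (4 * κ))).const_mul 2).mul hP').div
    hT' hT).sqrt

lemma le_regularizedSlope (hκ : 0 ≤ κ) (hτ : 0 < τ) (hρ : 0 ≤ ρ) (hv : τ * v ^ 2 ≤ 2 * ρ) :
    v ≤ regularizedSlope κ τ ρ := by
  refine Real.le_sqrt_of_sq_le ((le_div_iff₀' hτ).2 (hv.trans ?_))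
  gcongr
  exact le_mul_of_one_le_right zero_le_two (Real.one_le_exp (by positivity))

lemma le_regularizedSlope_add (hκ : 0 ≤ κ) (hT : 0 < T) (hP : 0 ≤ P) (hτ : 0 < τ) (hρ : 0 ≤ ρ)
    (hv0 : 0 ≤ v) (hv : τ * v ^ 2 ≤ 2 * ρ)
    (hvT : v ≤ Real.exp (2 * (κ * τ)) * regularizedSlope κ T P) :
    v ≤ regularizedSlope κ (T + τ) (P + ρ) := by
  have hexp : Real.exp (2 * (κ * τ)) ^ 2 * Real.exp (4 * κ * T) = Real.exp (4 * κ * (T + τ)) := by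
    rw [← Real.exp_nat_mul, ← Real.exp_add]
    congr 1
    push_cast
    ring
  have hT_sq : T * v ^ 2 ≤ 2 * Real.exp (4 * κ * (T + τ)) * P := by
    calc T * v ^ 2 ≤ T * (Real.exp (2 * (κ * τ)) * regularizedSlope κ T P) ^ 2 := by gcongr
      _ = 2 * Real.exp (4 * κ * (T + τ)) * P := by
        rw [mul_pow, regularizedSlope, Real.sq_sqrt (by positivity), ← hexp]
        field_simp
  have hτ_sq : τ * v ^ 2 ≤ 2 * Real.exp (4 * κ * (T + τ)) * ρ := by
    refine hv.trans ?_
    gcongr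
    exact le_mul_of_one_le_right zero_le_two (Real.one_le_exp (by positivity))
  refine Real.le_sqrt_of_sq_le ((le_div_iff₀' (by positivity)).2 ?_)
  linarith

end RegularizedSlope

section DiscreteSolution

variable {X : Type*} [MetricSpace X] {φ : X → EReal} {κ : ℝ} {x₀ : X} {t : ℕ → ℝ} {x : ℕ → X}

/-- The index used by `interpolatedCurve` at time `s`: that of the first time of the partition
which is not before `s`. -/
noncomputable def gridIndex (t : ℕ → ℝ) (s : ℝ) : ℕ := sInf {k : ℕ | s ≤ t k}

namespace IsDiscreteSolution

lemma step_pos (h : IsDiscreteSolution φ x₀ t x) (k : ℕ) : 0 < t (k + 1) - t k :=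
  sub_pos.2 (h.2.1 k.lt_succ_self)

lemma step_mem (h : IsDiscreteSolution φ x₀ t x) (k : ℕ) :
    x (k + 1) ∈ minimizerSet φ (t (k + 1) - t k) (x k) :=
  h.2.2.2.2 k

lemma mem_effDomain (h : IsDiscreteSolution φ x₀ t x) (hx₀ : x₀ ∈ effDomain φ) (k : ℕ) :
    x k ∈ effDomain φ := by
  induction k with
  | zero => rwa [h.2.2.2.1]
  | succ k ih => exact mem_effDomain_of_mem_minimizerSet ih (h.step_mem k)

lemma antitone_toReal (h : IsDiscreteSolution φ x₀ t x) (hbot : ∀ x, φ x ≠ ⊥)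
    (hx₀ : x₀ ∈ effDomain φ) : Antitone fun k => (φ (x k)).toReal :=
  antitone_nat_of_succ_le fun k =>
    toReal_le_of_mem_minimizerSet hbot (h.mem_effDomain hx₀ k) (h.step_pos k) (h.step_mem k)

lemma toReal_le (h : IsDiscreteSolution φ x₀ t x) (hbot : ∀ x, φ x ≠ ⊥)
    (hx₀ : x₀ ∈ effDomain φ) (k : ℕ) : (φ (x k)).toReal ≤ (φ x₀).toReal := by
  simpa only [h.2.2.2.1] using h.antitone_toReal hbot hx₀ k.zero_le

theorem globalSlopeLE (h : IsDiscreteSolution φ x₀ t x) (hbot : ∀ x, φ x ≠ ⊥)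
    (hx₀ : x₀ ∈ effDomain φ) (hconv : IsGeodConvex φ (-κ)) (hκ : 0 ≤ κ)
    (hmesh : ∀ k, κ * (t (k + 1) - t k) ≤ 1 / 2) {m n : ℕ} (hmn : m < n) :
    GlobalSlopeLE φ κ
      (regularizedSlope κ (t n - t m) ((φ (x m)).toReal - (φ (x n)).toReal)) (x n) := by
  have hanti : ∀ {j k}, j ≤ k → (φ (x k)).toReal ≤ (φ (x j)).toReal :=
    fun hjk => h.antitone_toReal hbot hx₀ hjk
  have hslope : ∀ k, GlobalSlopeLE φ κ (dist (x k) (x (k + 1)) / (t (k + 1) - t k)) (x (k + 1)) :=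
    fun k => (globalSlopeLE_of_mem_minimizerSet hbot (h.mem_effDomain hx₀ k) (h.step_pos k)
      (h.step_mem k)).of_isGeodConvex hbot hconv
  have hdrop : ∀ k, 0 ≤ (φ (x k)).toReal - (φ (x (k + 1))).toReal := fun k =>
    sub_nonneg.2 (hanti k.le_succ)
  have hspeed := fun k => mul_dist_div_sq_le_of_mem_minimizerSet hbot (h.mem_effDomain hx₀ k)
    (h.step_pos k) (h.step_mem k)
  replace hmn : m + 1 ≤ n := hmn
  induction n, hmn using Nat.le_induction with
  | base => exact (hslope m).mono (le_regularizedSlope hκ (h.step_pos m) (hdrop m) (hspeed m))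
  | succ n hmn ih =>
    have hle := le_regularizedSlope_add hκ (sub_pos.2 (h.2.1 hmn))
      (sub_nonneg.2 (hanti (Nat.le_of_succ_le hmn))) (h.step_pos n) (hdrop n)
      (div_nonneg dist_nonneg (h.step_pos n).le) (hspeed n)
      (ih.dist_div_le hbot hconv hκ (h.step_pos n) (hmesh n) (Real.sqrt_nonneg _)
        (h.step_mem n))
    rw [sub_add_sub_cancel', sub_add_sub_cancel] at hle
    exact (hslope n).mono hle

lemma le_gridIndex (h : IsDiscreteSolution φ x₀ t x) (s : ℝ) : s ≤ t (gridIndex t s) :=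
  Nat.sInf_mem (s := {k | s ≤ t k}) (h.2.2.1.eventually_ge_atTop s).exists

lemma monotone_gridIndex (h : IsDiscreteSolution φ x₀ t x) : Monotone (gridIndex t) :=
  fun _ s' hs => Nat.sInf_le (hs.trans (h.le_gridIndex s'))

lemma gridIndex_le_add (h : IsDiscreteSolution φ x₀ t x) {s ε : ℝ} (hs : 0 ≤ s)
    (hε : ∀ k, t (k + 1) - t k ≤ ε) : t (gridIndex t s) ≤ s + ε := by
  rcases hk : gridIndex t s with _ | k
  · rw [h.1]
    linarith [h.step_pos 0, hε 0]
  · have hlt : t k < s := not_le.1 (Nat.notMem_of_lt_sInf (s := {k | s ≤ t k})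
      (k.lt_succ_self.trans_eq hk.symm))
    linarith [hε k]

end IsDiscreteSolution

end DiscreteSolution

section GradientCurve

variable {X : Type*} [MetricSpace X] {φ : X → EReal} {κ a b : ℝ} {x₀ : X} {ξ : ℝ → X}
  {t : ℕ → ℕ → ℝ} {x : ℕ → ℕ → X}

/-- The data behind `IsGradientCurve φ x₀ ξ`: discrete solutions `x i` for partitions `t i` of
vanishing mesh, whose interpolated curves converge to `ξ`. -/
structure IsSchemeLimit (φ : X → EReal) (x₀ : X) (t : ℕ → ℕ → ℝ) (x : ℕ → ℕ → X) (ξ : ℝ → X) :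
    Prop where
  sol : ∀ i, IsDiscreteSolution φ x₀ (t i) (x i)
  mesh : ∀ ε : ℝ, 0 < ε → ∀ᶠ i in atTop, ∀ k, t i (k + 1) - t i k ≤ ε
  lim : ∀ s : ℝ, 0 ≤ s → Tendsto (fun i => x i (gridIndex (t i) s)) atTop (𝓝 (ξ s))

lemma IsGradientCurve.exists_isSchemeLimit (hξ : IsGradientCurve φ x₀ ξ) :
    ∃ t x, IsSchemeLimit φ x₀ t x ξ := by
  obtain ⟨t, x, hsol, hmesh, hlim⟩ := hξ
  exact ⟨t, x, hsol, hmesh, hlim⟩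

namespace IsSchemeLimit

lemma tendsto_grid (h : IsSchemeLimit φ x₀ t x ξ) (ha : 0 ≤ a) :
    Tendsto (fun i => t i (gridIndex (t i) a)) atTop (𝓝 a) := by
  rw [Metric.tendsto_nhds]
  intro ε hε
  filter_upwards [h.mesh (ε / 2) (by positivity)] with i hi
  have hge := (h.sol i).le_gridIndex a
  have hle := (h.sol i).gridIndex_le_add ha hi
  rw [Real.dist_eq, abs_lt]
  constructor <;> linarith

lemma mem_effDomain (h : IsSchemeLimit φ x₀ t x ξ) (hbot : ∀ x, φ x ≠ ⊥)
    (hlsc : LowerSemicontinuous φ) (hx₀ : x₀ ∈ effDomain φ) (ha : 0 ≤ a) : ξ a ∈ effDomain φ :=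
  (mem_effDomain_and_toReal_le_of_tendsto hbot hlsc (h.lim a ha) (.of_forall fun i =>
    ⟨(h.sol i).mem_effDomain hx₀ _, (h.sol i).toReal_le hbot hx₀ _⟩)).1

lemma eventually_globalSlopeLE (h : IsSchemeLimit φ x₀ t x ξ) (hbot : ∀ x, φ x ≠ ⊥)
    (hx₀ : x₀ ∈ effDomain φ) (hconv : IsGeodConvex φ (-κ)) (hκ : 0 ≤ κ)
    (ha : 0 ≤ a) (hab : a < b) :
    ∀ᶠ i in atTop, GlobalSlopeLE φ κ
      (regularizedSlope κ (t i (gridIndex (t i) b) - t i (gridIndex (t i) a))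
        ((φ (x i (gridIndex (t i) a))).toReal - (φ (x i (gridIndex (t i) b))).toReal))
      (x i (gridIndex (t i) b)) := by
  have hgrid := (h.tendsto_grid ha).eventually_lt_const hab
  filter_upwards [h.mesh (1 / (2 * (κ + 1))) (by positivity), hgrid] with i hmesh hi
  refine (h.sol i).globalSlopeLE hbot hx₀ hconv hκ (fun k => ?_)
    ((h.sol i).2.1.lt_iff_lt.1 (hi.trans_le ((h.sol i).le_gridIndex b)))
  calc κ * (t i (k + 1) - t i k) ≤ κ * (1 / (2 * (κ + 1))) := by
        gcongr
        exact hmesh k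
    _ ≤ 1 / 2 := by
        rw [mul_one_div, div_le_div_iff₀ (by positivity) two_pos]
        linarith

/-- The slopes of the discrete solutions at time `a` are bounded, as their energies cannot drop
below any `c < φ(ξ(a))`. -/
lemma tendsto_toReal (h : IsSchemeLimit φ x₀ t x ξ) (hbot : ∀ x, φ x ≠ ⊥)
    (hlsc : LowerSemicontinuous φ) (hx₀ : x₀ ∈ effDomain φ) (hconv : IsGeodConvex φ (-κ))
    (hκ : 0 ≤ κ) (ha : 0 < a) :
    Tendsto (fun i => (φ (x i (gridIndex (t i) a))).toReal) atTop (𝓝 (φ (ξ a)).toReal) := by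
  have hξa := h.mem_effDomain hbot hlsc hx₀ ha.le
  have hge : ∀ᶠ i in atTop, (φ (ξ a)).toReal - 1 < (φ (x i (gridIndex (t i) a))).toReal :=
    eventually_lt_toReal_of_tendsto hbot hlsc (h.lim a ha.le) hξa
      (.of_forall fun i => (h.sol i).mem_effDomain hx₀ _) (sub_one_lt _)
  have hspan : Tendsto (fun i => t i (gridIndex (t i) a) - t i (gridIndex (t i) 0)) atTop
      (𝓝 (a - 0)) := (h.tendsto_grid ha.le).sub (h.tendsto_grid le_rfl)
  rw [sub_zero] at hspan
  refine GlobalSlopeLE.tendsto_toReal (κ := κ) hbot hlsc hξa (h.lim a ha.le)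
    (tendsto_regularizedSlope (κ := κ) ha.ne' hspan
      (tendsto_const_nhds (x := (φ x₀).toReal - ((φ (ξ a)).toReal - 1)))) ?_
  filter_upwards [h.eventually_globalSlopeLE hbot hx₀ hconv hκ le_rfl ha, hge,
    hspan.eventually_const_lt ha] with i hi hge hpos
  have hle := (h.sol i).toReal_le hbot hx₀ (gridIndex (t i) 0)
  exact hi.mono (regularizedSlope_mono hpos (by linarith))

end IsSchemeLimit

namespace IsGradientCurve

lemma mem_effDomain (hξ : IsGradientCurve φ x₀ ξ) (hbot : ∀ x, φ x ≠ ⊥)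
    (hlsc : LowerSemicontinuous φ) (hx₀ : x₀ ∈ effDomain φ) (ha : 0 ≤ a) : ξ a ∈ effDomain φ :=
  let ⟨_, _, h⟩ := hξ.exists_isSchemeLimit
  h.mem_effDomain hbot hlsc hx₀ ha

lemma antitoneOn_toReal (hξ : IsGradientCurve φ x₀ ξ) (hbot : ∀ x, φ x ≠ ⊥)
    (hlsc : LowerSemicontinuous φ) (hx₀ : x₀ ∈ effDomain φ) (hconv : IsGeodConvex φ (-κ))
    (hκ : 0 ≤ κ) : AntitoneOn (fun s => (φ (ξ s)).toReal) (Set.Ioi 0) := by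
  obtain ⟨t, x, h⟩ := hξ.exists_isSchemeLimit
  intro a ha b hb hab
  exact le_of_tendsto_of_tendsto' (h.tendsto_toReal hbot hlsc hx₀ hconv hκ hb)
    (h.tendsto_toReal hbot hlsc hx₀ hconv hκ ha)
    fun i => (h.sol i).antitone_toReal hbot hx₀ ((h.sol i).monotone_gridIndex hab)

theorem globalSlopeLE (hξ : IsGradientCurve φ x₀ ξ) (hbot : ∀ x, φ x ≠ ⊥)
    (hlsc : LowerSemicontinuous φ) (hx₀ : x₀ ∈ effDomain φ) (hconv : IsGeodConvex φ (-κ))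
    (hκ : 0 ≤ κ) (ha : 0 < a) (hab : a < b) :
    GlobalSlopeLE φ κ
      (regularizedSlope κ (b - a) ((φ (ξ a)).toReal - (φ (ξ b)).toReal)) (ξ b) := by
  obtain ⟨t, x, h⟩ := hξ.exists_isSchemeLimit
  have hb : 0 < b := ha.trans hab
  exact .of_tendsto hbot hlsc (h.mem_effDomain hbot hlsc hx₀ hb.le) (h.lim b hb.le)
    (tendsto_regularizedSlope (sub_ne_zero.2 hab.ne')
      ((h.tendsto_grid hb.le).sub (h.tendsto_grid ha.le))
      ((h.tendsto_toReal hbot hlsc hx₀ hconv hκ ha).sub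
        (h.tendsto_toReal hbot hlsc hx₀ hconv hκ hb)))
    (h.eventually_globalSlopeLE hbot hx₀ hconv hκ ha.le hab)

end IsGradientCurve

end GradientCurve

section Stationary

variable {X : Type*} [MetricSpace X] {φ : X → EReal} {κ : ℝ} {x : X}

lemma GlobalSlopeLE.minimizerSet_eq_singleton (hbot : ∀ x, φ x ≠ ⊥) (h : GlobalSlopeLE φ κ 0 x)
    {τ : ℝ} (hτ : 0 < τ) (hκτ : κ < 1 / τ) : minimizerSet φ τ x = {x} := by
  have hdiv : ∀ d : ℝ, d ^ 2 / (2 * τ) = 1 / τ / 2 * d ^ 2 := fun d => by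
    field_simp
  refine Set.eq_singleton_iff_unique_mem.2
    ⟨(mem_minimizerSet_iff hbot h.mem).2 fun z hz => ?_, fun p hp => ?_⟩
  · have hz' := h.sub_le z hz
    have hκ' : κ / 2 * dist x z ^ 2 ≤ 1 / τ / 2 * dist x z ^ 2 := by gcongr
    rw [hdiv, hdiv, dist_self]
    linarith
  · have hpD := mem_effDomain_of_mem_minimizerSet h.mem hp
    have hmin := toReal_sub_le_of_mem_minimizerSet hbot h.mem hp h.mem
    rw [sub_div, hdiv, hdiv, dist_self] at hmin
    by_contra hne
    have hlt : κ / 2 * dist x p ^ 2 < 1 / τ / 2 * dist x p ^ 2 := by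
      have := dist_pos.2 (Ne.symm hne)
      gcongr
    linarith [h.sub_le p hpD]

lemma isGradientCurve_const {δ : ℝ} (hδ : 0 < δ)
    (h : ∀ τ : ℝ, 0 < τ → τ ≤ δ → x ∈ minimizerSet φ τ x) :
    IsGradientCurve φ x fun _ => x := by
  set τ : ℕ → ℝ := fun i => δ / (i + 1)
  have hτ : ∀ i, 0 < τ i := fun i => by positivity
  have hτδ : ∀ i, τ i ≤ δ := fun i => div_le_self hδ.le (by simp)
  have hτ0 : Tendsto τ atTop (𝓝 0) := by
    simpa [τ, div_eq_mul_inv] using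
      (tendsto_one_div_add_atTop_nhds_zero_nat (𝕜 := ℝ)).const_mul δ
  have hstep : ∀ i k : ℕ, ((k + 1 : ℕ) : ℝ) * τ i - k * τ i = τ i := fun i k => by
    push_cast
    ring
  refine ⟨fun i k => k * τ i, fun _ _ => x, fun i => ⟨by simp, fun k k' hk => ?_,
    tendsto_natCast_atTop_atTop.atTop_mul_const (hτ i), rfl, fun k => ?_⟩, fun ε hε => ?_,
    fun _ _ => tendsto_const_nhds⟩
  · exact mul_lt_mul_of_pos_right (Nat.cast_lt.2 hk) (hτ i)
  · simpa only [hstep] using h _ (hτ i) (hτδ i)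
  · filter_upwards [hτ0.eventually_le_const hε] with i hi k
    exact (hstep i k).trans_le hi

lemma IsGradientCurve.eq_of_minimizerSet_eq_singleton {δ : ℝ} (hδ : 0 < δ)
    (h : ∀ τ : ℝ, 0 < τ → τ ≤ δ → minimizerSet φ τ x = {x}) {ζ : ℝ → X}
    (hζ : IsGradientCurve φ x ζ) {s : ℝ} (hs : 0 ≤ s) : ζ s = x := by
  obtain ⟨t, y, hζ⟩ := hζ.exists_isSchemeLimit
  refine tendsto_nhds_unique (hζ.lim s hs) (tendsto_const_nhds.congr' ?_)
  filter_upwards [hζ.mesh δ hδ] with i hi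
  have hconst : ∀ k, y i k = x := by
    intro k
    induction k with
    | zero => exact (hζ.sol i).2.2.2.1
    | succ k ih =>
      have hk := (hζ.sol i).step_mem k
      rwa [ih, h _ ((hζ.sol i).step_pos k) (hi k), Set.mem_singleton_iff] at hk
  exact (hconst _).symm

theorem GlobalSlopeLE.isStationaryPoint (hbot : ∀ x, φ x ≠ ⊥) (h : GlobalSlopeLE φ κ 0 x) :
    IsStationaryPoint φ x := by
  have hδ : 0 < 1 / (|κ| + 1) := by positivity
  have hsingle : ∀ τ : ℝ, 0 < τ → τ ≤ 1 / (|κ| + 1) → minimizerSet φ τ x = {x} :=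
    fun τ hτ hτκ => h.minimizerSet_eq_singleton hbot hτ <|
      calc κ < |κ| + 1 := by linarith [le_abs_self κ]
        _ ≤ 1 / τ := (le_one_div (by positivity) hτ).2 hτκ
  exact ⟨h.mem, isGradientCurve_const hδ fun τ hτ hτκ => by simp [hsingle τ hτ hτκ],
    fun ζ hζ s hs => hζ.eq_of_minimizerSet_eq_singleton hδ hsingle hs⟩

end Stationary

section LargeTime

variable {X : Type*} [MetricSpace X] {φ : X → EReal} {κ : ℝ} {x₀ : X} {ξ : ℝ → X}

lemma exists_tendsto_of_antitoneOn_Ioi {g : ℝ → ℝ} {a c : ℝ} (hg : AntitoneOn g (Set.Ioi a))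
    (hc : ∀ᶠ s in atTop, c ≤ g s) : ∃ G, Tendsto g atTop (𝓝 G) := by
  have hmem : ∀ s, max s (a + 1) ∈ Set.Ioi a := fun s => lt_max_of_lt_right (lt_add_one a)
  have hanti : Antitone fun s => g (max s (a + 1)) := fun s s' hs =>
    hg (hmem s) (hmem s') (max_le_max_right _ hs)
  have heq : (fun s => g (max s (a + 1))) =ᶠ[atTop] g := by
    filter_upwards [eventually_ge_atTop (a + 1)] with s hs
    rw [max_eq_left hs]
  rcases tendsto_atTop_of_antitone hanti with hinf | ⟨G, hG⟩
  · obtain ⟨s, hle, hlt⟩ := (hc.and ((hinf.congr' heq).eventually_lt_atBot c)).exists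
    exact absurd hlt hle.not_gt
  · exact ⟨G, hG.congr' heq⟩

theorem IsGradientCurve.exists_tendsto_globalSlopeLE (hξ : IsGradientCurve φ x₀ ξ)
    (hbot : ∀ x, φ x ≠ ⊥) (hlsc : LowerSemicontinuous φ) (hx₀ : x₀ ∈ effDomain φ)
    (hconv : IsGeodConvex φ (-κ)) (hκ : 0 ≤ κ) {c : ℝ}
    (hc : ∀ᶠ s in atTop, c ≤ (φ (ξ s)).toReal) :
    ∃ (G : ℝ) (q : ℝ → ℝ), Tendsto (fun s => (φ (ξ s)).toReal) atTop (𝓝 G) ∧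
      Tendsto q atTop (𝓝 0) ∧ ∀ᶠ s in atTop, GlobalSlopeLE φ κ (q s) (ξ s) := by
  obtain ⟨G, hG⟩ :=
    exists_tendsto_of_antitoneOn_Ioi (hξ.antitoneOn_toReal hbot hlsc hx₀ hconv hκ) hc
  have hshift : Tendsto (fun s : ℝ => s - 1) atTop atTop :=
    tendsto_atTop_add_const_right _ (-1) tendsto_id
  have hdrop : Tendsto (fun s => (φ (ξ (s - 1))).toReal - (φ (ξ s)).toReal) atTop (𝓝 0) := by
    simpa using (hG.comp hshift).sub hG
  refine ⟨G, fun s => regularizedSlope κ 1 ((φ (ξ (s - 1))).toReal - (φ (ξ s)).toReal), hG, ?_, ?_⟩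
  · simpa only [regularizedSlope_zero] using
      tendsto_regularizedSlope one_ne_zero tendsto_const_nhds hdrop
  · filter_upwards [eventually_gt_atTop 1] with s hs
    simpa only [sub_sub_cancel] using
      hξ.globalSlopeLE hbot hlsc hx₀ hconv hκ (sub_pos.2 hs) (sub_one_lt s)

theorem IsGradientCurve.tendsto_localSlope (hξ : IsGradientCurve φ x₀ ξ)
    (hbot : ∀ x, φ x ≠ ⊥) (hlsc : LowerSemicontinuous φ) (hx₀ : x₀ ∈ effDomain φ)
    (hconv : IsGeodConvex φ (-κ)) (hκ : 0 ≤ κ) {c : ℝ}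
    (hc : ∀ᶠ s in atTop, (c : EReal) ≤ φ (ξ s)) :
    Tendsto (fun s => localSlope φ (ξ s)) atTop (𝓝 0) := by
  have hc' : ∀ᶠ s in atTop, c ≤ (φ (ξ s)).toReal := by
    filter_upwards [hc, eventually_ge_atTop 0] with s hs hs0
    rwa [← EReal.coe_toReal (hξ.mem_effDomain hbot hlsc hx₀ hs0) (hbot _),
      EReal.coe_le_coe_iff] at hs
  obtain ⟨G, q, -, hq, hslope⟩ :=
    hξ.exists_tendsto_globalSlopeLE hbot hlsc hx₀ hconv hκ hc'
  have hq' := ENNReal.tendsto_ofReal hq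
  rw [ENNReal.ofReal_zero] at hq'
  exact tendsto_of_tendsto_of_tendsto_of_le_of_le' tendsto_const_nhds hq'
    (.of_forall fun _ => zero_le) (hslope.mono fun s hs => hs.localSlope_le hbot)

theorem IsGradientCurve.globalSlopeLE_zero_of_tendsto (hξ : IsGradientCurve φ x₀ ξ)
    (hbot : ∀ x, φ x ≠ ⊥) (hlsc : LowerSemicontinuous φ) (hx₀ : x₀ ∈ effDomain φ)
    (hconv : IsGeodConvex φ (-κ)) (hκ : 0 ≤ κ) {ι : Type*} {l : Filter ι} [l.NeBot] {u : ι → ℝ}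
    {y : X} (hu : Tendsto u l atTop) (hy : Tendsto (fun i => ξ (u i)) l (𝓝 y)) :
    GlobalSlopeLE φ κ 0 y ∧ Tendsto (fun s => φ (ξ s)) atTop (𝓝 (φ y)) := by
  have hmem : ∀ s, 0 ≤ s → ξ s ∈ effDomain φ := fun s => hξ.mem_effDomain hbot hlsc hx₀
  have hle : ∀ s, 0 < s → y ∈ effDomain φ ∧ (φ y).toReal ≤ (φ (ξ s)).toReal := fun s hs => by
    refine mem_effDomain_and_toReal_le_of_tendsto hbot hlsc hy ?_
    filter_upwards [hu.eventually_ge_atTop s] with i hi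
    exact ⟨hmem _ (hs.le.trans hi),
      hξ.antitoneOn_toReal hbot hlsc hx₀ hconv hκ hs (hs.trans_le hi) hi⟩
  have hyD := (hle 1 one_pos).1
  obtain ⟨G, q, hG, hq, hslope⟩ := hξ.exists_tendsto_globalSlopeLE hbot hlsc hx₀ hconv hκ
    ((eventually_gt_atTop 0).mono fun s hs => (hle s hs).2)
  have hGy : G = (φ y).toReal := tendsto_nhds_unique (hG.comp hu)
    (GlobalSlopeLE.tendsto_toReal hbot hlsc hyD hy (hq.comp hu) (hu.eventually hslope))
  refine ⟨.of_tendsto hbot hlsc hyD hy (hq.comp hu) (hu.eventually hslope), ?_⟩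
  rw [← EReal.coe_toReal hyD (hbot y), ← hGy]
  refine (EReal.tendsto_coe.2 hG).congr' ?_
  filter_upwards [eventually_ge_atTop 0] with s hs
  exact EReal.coe_toReal (hmem s hs) (hbot _)

end LargeTime

theorem theorem4p9_general {X : Type*} [MetricSpace X]
    (φ : X → EReal) (hbot : ∀ x, φ x ≠ ⊥) (hlsc : LowerSemicontinuous φ) (lam : ℝ)
    (hconv : IsGeodConvex φ lam)
    (x₀ : X) (hx₀ : x₀ ∈ effDomain φ) (ξ : ℝ → X) (hξ : IsGradientCurve φ x₀ ξ) :
    ((∃ c : ℝ, ∀ᶠ t in atTop, (c : EReal) ≤ φ (ξ t)) →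
      Tendsto (fun t => localSlope φ (ξ t)) atTop (𝓝 0)) ∧
    (∀ (u : ℕ → ℝ) (y : X), Tendsto u atTop atTop →
      Tendsto (fun n => ξ (u n)) atTop (𝓝 y) →
      localSlope φ y = 0 ∧ IsStationaryPoint φ y ∧
        Tendsto (fun t => φ (ξ t)) atTop (𝓝 (φ y))) := by
  have hconv' : IsGeodConvex φ (-|lam|) := hconv.mono (neg_abs_le lam)
  refine ⟨fun ⟨c, hc⟩ => hξ.tendsto_localSlope hbot hlsc hx₀ hconv' (abs_nonneg lam) hc,
    fun u y hu hy => ?_⟩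
  obtain ⟨hslope, hlim⟩ :=
    hξ.globalSlopeLE_zero_of_tendsto hbot hlsc hx₀ hconv' (abs_nonneg lam) hu hy
  have hzero : localSlope φ y ≤ 0 := by simpa using hslope.localSlope_le hbot
  exact ⟨le_antisymm hzero zero_le, hslope.isStationaryPoint hbot, hlim⟩

theorem theorem4p9 {X : Type*} [MetricSpace X] [CompleteSpace X]
    (φ : X → EReal) (hbot : ∀ x, φ x ≠ ⊥) (hlsc : LowerSemicontinuous φ) (lam : ℝ)
    (hcase : CaseCATOne φ lam ∨ CaseCommutative φ lam)
    (x₀ : X) (hx₀ : x₀ ∈ effDomain φ) (ξ : ℝ → X) (hξ : IsGradientCurve φ x₀ ξ) :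
    ((∃ c : ℝ, ∀ᶠ t in atTop, (c : EReal) ≤ φ (ξ t)) →
      Tendsto (fun t => localSlope φ (ξ t)) atTop (𝓝 0)) ∧
    (∀ (u : ℕ → ℝ) (y : X), Tendsto u atTop atTop →
      Tendsto (fun n => ξ (u n)) atTop (𝓝 y) →
      localSlope φ y = 0 ∧ IsStationaryPoint φ y ∧
        Tendsto (fun t => φ (ξ t)) atTop (𝓝 (φ y))) :=
  theorem4p9_general φ hbot hlsc lam
    (hcase.elim (fun h => h.2) CaseCommutative.isGeodConvex) x₀ hx₀ ξ hξ
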